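/- Let $f(z)=\exp(z)$ for $z\in\mathbb{C}$, let $f^n$ denote the $n$-fold iterate of $f$ (with $f^0=\mathrm{id}$), and let $$\Lambda=\{z\in\mathbb{C} : \operatorname{Im}(f^n(z))\in[0,\pi]\ \text{for all } n\ge 0\}$$ be the set which underlies Devaney's indecomposable continuum. Then the Hausdorff dimension of $\Lambda$, with respect to the Euclidean metric on $\mathbb{C}$, equals $1$. -/

import Mathlib

/-- Devaney's set for the exponential map: all complex points whose whole forward orbit under
`z ↦ exp z` (the point itself included) stays in the closed horizontal strip
`0 ≤ Im ≤ π`. -/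
def devaneyContinuum : Set ℂ :=
  {z : ℂ | ∀ n : ℕ, (Complex.exp^[n] z).im ∈ Set.Icc (0 : ℝ) Real.pi}

/-! The lower bound holds because `Λ` contains the real line. For the upper bound fix `1 < s ≤ 2`
and let `M` be the supremum of the `s`-dimensional contents of the unit-width slabs of `Λ` with `Re
≥ R`. Content is used instead of Hausdorff measure because it is finite on bounded sets, so `M ≤ M /
2` forces `M = 0`.

That inequality is `content_slab_pos_le`. On a slab at abscissa `x`, `exp` expands by at least `e^x
/ 2`, and the image lies in about `e^x` unit slabs far to the right or left. A left slab is sent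
close to `0`; small discs there follow the real orbit `0, 1, e, ...` with bounded total distortion
until they are large and far right, so left slabs also cost only a multiple of `M`
(`content_slab_neg_le`). Altogether `M ≤ C e^{-(s-1)R} M`, and `R` is taken large.

Points whose orbit ever reaches `Re ≥ R` thus form a countable union of sets of content zero. The
remaining orbits stay in `Re < R`, hence away from the real axis, where `exp` uniformly expands the
hyperbolic metric of the half-plane; at most one point has such an orbit (`subsingleton_bddOrbits`).
-/

open Set Filter Topology MeasureTheory Metric
open scoped ENNReal NNReal

/-! ### Hausdorff content and dimension -/

/-- The `s`-dimensional Hausdorff content (covers by sets of arbitrary diameter). -/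
noncomputable def hausdorffContent (X : Type*) [PseudoEMetricSpace X] (s : ℝ) : OuterMeasure X :=
  OuterMeasure.ofFunction (fun t => ⨆ _ : t.Nonempty, ediam t ^ s) (by simp)

theorem hausdorffContent_le_ediam {X : Type*} [PseudoEMetricSpace X] (s : ℝ) (A : Set X) :
    hausdorffContent X s A ≤ ediam A ^ s :=
  (OuterMeasure.ofFunction_le A).trans (iSup_le fun _ => le_rfl)

/-- A cover whose sum is below `r ^ s` has all diameters at most `r`, so covers with small sums are
automatically fine. -/
theorem hausdorffMeasure_eq_zero_of_content {X : Type*} [EMetricSpace X] [MeasurableSpace X]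
    [BorelSpace X] {s : ℝ} (hs : 0 < s) {A : Set X} (hA : hausdorffContent X s A = 0) :
    μH[s] A = 0 := by
  rw [Measure.hausdorffMeasure_apply]
  refine le_antisymm (iSup₂_le fun r hr => ?_) bot_le
  refine ENNReal.le_of_forall_pos_le_add fun ε hε _ => ?_
  rw [zero_add]
  have hpos : 0 < min (ε : ℝ≥0∞) (r ^ s) :=
    lt_min (by exact_mod_cast hε) (ENNReal.rpow_pos_of_nonneg hr hs.le)
  rw [hausdorffContent, OuterMeasure.ofFunction_apply] at hA
  obtain ⟨t, ht⟩ := iInf_lt_iff.1 (hA.trans_lt hpos)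
  obtain ⟨hcov, hsum⟩ := iInf_lt_iff.1 ht
  refine iInf_le_of_le t (iInf_le_of_le hcov (iInf_le_of_le (fun n => ?_) ?_))
  · rcases (t n).eq_empty_or_nonempty with h | h
    · simp [h]
    · have h1 : ediam (t n) ^ s ≤ r ^ s :=
        calc ediam (t n) ^ s = ⨆ _ : (t n).Nonempty, ediam (t n) ^ s := by simp [h]
          _ ≤ ∑' n, ⨆ _ : (t n).Nonempty, ediam (t n) ^ s :=
            ENNReal.le_tsum (f := fun n => ⨆ _ : (t n).Nonempty, ediam (t n) ^ s) n
          _ ≤ r ^ s := hsum.le.trans (min_le_right _ _)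
      exact (ENNReal.rpow_le_rpow_iff hs).1 h1
  · exact hsum.le.trans (min_le_left _ _)

theorem dimH_le_of_content_eq_zero {X : Type*} [EMetricSpace X] {s : ℝ≥0} (hs : 0 < s)
    {A : Set X} (hA : hausdorffContent X s A = 0) : dimH A ≤ s := by
  borelize X
  refine dimH_le_of_hausdorffMeasure_ne_top ?_
  rw [hausdorffMeasure_eq_zero_of_content (by exact_mod_cast hs) hA]
  exact ENNReal.zero_ne_top

/-- A map that does not shrink distances on `A` by more than a factor `κ⁻¹` controls the content
of `A` by that of its image. -/
theorem hausdorffContent_le_image {X Y : Type*} [PseudoMetricSpace X] [PseudoMetricSpace Y]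
    {s κ : ℝ} (hs : 0 ≤ s) (hκ : 0 < κ) {f : X → Y} {A : Set X}
    (hf : ∀ x ∈ A, ∀ y ∈ A, dist x y ≤ κ * dist (f x) (f y)) {B : Set Y} (hB : MapsTo f A B) :
    hausdorffContent X s A ≤ ENNReal.ofReal (κ ^ s) * hausdorffContent Y s B := by
  have hc0 : ENNReal.ofReal (κ ^ s) ≠ 0 := by
    have := Real.rpow_pos_of_pos hκ s
    simpa using this
  rw [hausdorffContent, hausdorffContent, OuterMeasure.ofFunction_apply,
    OuterMeasure.ofFunction_apply, ENNReal.mul_iInf_of_ne hc0 ENNReal.ofReal_ne_top]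
  refine le_iInf fun t => ?_
  rw [ENNReal.mul_iInf_of_ne hc0 ENNReal.ofReal_ne_top]
  refine le_iInf fun ht => ?_
  refine iInf_le_of_le (fun n => A ∩ f ⁻¹' t n) (iInf_le_of_le ?_ ?_)
  · intro x hx
    obtain ⟨n, hn⟩ := mem_iUnion.1 (ht (hB hx))
    exact mem_iUnion.2 ⟨n, hx, hn⟩
  · rw [← ENNReal.tsum_mul_left]
    refine ENNReal.tsum_le_tsum fun n => iSup_le fun hne => ?_
    have hne' : (t n).Nonempty := hne.elim fun x hx => ⟨f x, hx.2⟩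
    rw [iSup_pos hne', ← ENNReal.ofReal_rpow_of_pos hκ, ← ENNReal.mul_rpow_of_nonneg _ _ hs]
    refine ENNReal.rpow_le_rpow (ediam_le_iff.2 fun x hx y hy => ?_) hs
    calc edist x y = ENNReal.ofReal (dist x y) := edist_dist x y
      _ ≤ ENNReal.ofReal (κ * dist (f x) (f y)) :=
        ENNReal.ofReal_le_ofReal (hf x hx.1 y hy.1)
      _ = ENNReal.ofReal κ * edist (f x) (f y) := by
        rw [ENNReal.ofReal_mul hκ.le, edist_dist]
      _ ≤ _ := by gcongr; exact edist_le_ediam_of_mem hx.2 hy.2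

/-! ### Euclidean expansion of the exponential -/

namespace Complex

theorem normSq_exp_sub_exp (z w : ℂ) :
    normSq (exp z - exp w) = (Real.exp z.re - Real.exp w.re) ^ 2 +
      2 * (Real.exp z.re * Real.exp w.re) * (1 - Real.cos (z.im - w.im)) := by
  rw [normSq_apply, Real.cos_sub]
  simp only [sub_re, sub_im, exp_re, exp_im]
  have h1 := Real.sin_sq_add_cos_sq z.im
  have h2 := Real.sin_sq_add_cos_sq w.im
  linear_combination (Real.exp z.re) ^ 2 * h1 + (Real.exp w.re) ^ 2 * h2

theorem dist_le_mul_dist_exp {x : ℝ} {z w : ℂ} (hz : x ≤ z.re) (hw : x ≤ w.re)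
    (hzi : z.im ∈ Icc 0 Real.pi) (hwi : w.im ∈ Icc 0 Real.pi) :
    dist z w ≤ 2 * Real.exp (-x) * dist (exp z) (exp w) := by
  have hx := Real.exp_pos x
  have key : Real.exp x ^ 2 * ((z.re - w.re) ^ 2 + (z.im - w.im) ^ 2) ≤
      4 * normSq (exp z - exp w) := by
    rw [normSq_exp_sub_exp]
    have h1 : ∀ p q : ℝ, x ≤ q → q ≤ p →
        Real.exp x ^ 2 * (p - q) ^ 2 ≤ (Real.exp p - Real.exp q) ^ 2 := by
      intro p q hq hpq
      rw [← mul_pow]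
      have : Real.exp p = Real.exp q * Real.exp (p - q) := by rw [← Real.exp_add]; ring_nf
      have h2 := Real.add_one_le_exp (p - q)
      have h3 := Real.exp_le_exp.2 hq
      refine pow_le_pow_left₀ (mul_nonneg hx.le (by linarith)) ?_ 2
      rw [this]
      nlinarith
    have h2 : Real.exp x ^ 2 * (z.re - w.re) ^ 2 ≤ (Real.exp z.re - Real.exp w.re) ^ 2 := by
      rcases le_total w.re z.re with h | h
      · exact h1 _ _ hw h
      · have := h1 _ _ hz h
        nlinarith
    -- The strip has height `π`, so `1 - cos t ≥ 2 t² / π² ≥ t² / 8` applies to the difference of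
    -- heights.
    have h3 : 2 * (z.im - w.im) ^ 2 ≤ 16 * (1 - Real.cos (z.im - w.im)) := by
      have h4 := Real.cos_le_one_sub_mul_cos_sq (x := z.im - w.im)
        (abs_le.2 ⟨by linarith [hzi.1, hwi.2], by linarith [hzi.2, hwi.1]⟩)
      have h5 : (1 : ℝ) / 8 ≤ 2 / Real.pi ^ 2 := by
        rw [div_le_div_iff₀ (by norm_num) (by positivity)]
        nlinarith [Real.pi_le_four, Real.pi_pos]
      nlinarith [sq_nonneg (z.im - w.im)]
    have h6 : Real.exp x ^ 2 ≤ Real.exp z.re * Real.exp w.re := by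
      rw [sq]
      exact mul_le_mul (Real.exp_le_exp.2 hz) (Real.exp_le_exp.2 hw) hx.le (Real.exp_pos _).le
    have h7 : 0 ≤ 1 - Real.cos (z.im - w.im) := by linarith [Real.cos_le_one (z.im - w.im)]
    nlinarith [mul_le_mul h6 h3 (by positivity) (by positivity), sq_nonneg (Real.exp z.re - Real.exp w.re)]
  rw [Real.exp_neg, dist_eq, dist_eq]
  have h8 : Real.exp x * ‖z - w‖ ≤ 2 * ‖exp z - exp w‖ := by
    refine (pow_le_pow_iff_left₀ (by positivity) (by positivity) two_ne_zero).1 ?_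
    rw [mul_pow, mul_pow, ← normSq_eq_norm_sq, ← normSq_eq_norm_sq, normSq_apply (z - w)]
    simp only [sub_re, sub_im]
    linarith
  calc ‖z - w‖ = (Real.exp x)⁻¹ * (Real.exp x * ‖z - w‖) := by field_simp
    _ ≤ (Real.exp x)⁻¹ * (2 * ‖exp z - exp w‖) := by gcongr
    _ = _ := by ring

theorem norm_exp_sub_exp_le_of_norm_le {a ρ : ℝ} {z : ℂ} (hz : ‖z - a‖ ≤ ρ) :
    ‖exp z - exp a‖ ≤ Real.exp a * (Real.exp ρ - 1) := by
  have h : exp z - exp a = exp a * (exp (z - a) - 1) := by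
    rw [mul_sub, ← exp_add]; ring_nf
  rw [h, norm_mul, norm_exp, ofReal_re]
  gcongr
  have := norm_exp_sub_sum_le_exp_norm_sub_sum (z - a) 1
  simp only [Finset.range_one, Finset.sum_singleton, pow_zero, Nat.factorial_zero, Nat.cast_one,
    div_one] at this
  linarith [Real.exp_le_exp.2 hz]

/-- The mean value inequality for `exp z - e^a z` gives expansion by `e^a (2 - e^ρ)`, and `2 - e^ρ ≥
e^{-3ρ}` for `ρ ≤ 1/2`. The exponential form lets distortions multiply along an orbit. -/
theorem dist_le_mul_dist_exp_of_mem_closedBall {a ρ : ℝ} (hρ : ρ ≤ 1 / 2) {z w : ℂ}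
    (hz : z ∈ closedBall (a : ℂ) ρ) (hw : w ∈ closedBall (a : ℂ) ρ) :
    dist z w ≤ Real.exp (3 * ρ - a) * dist (exp z) (exp w) := by
  have hρ0 : 0 ≤ ρ := dist_nonneg.trans (mem_closedBall.1 hz)
  have hmv := (convex_closedBall (a : ℂ) ρ).norm_image_sub_le_of_norm_hasDerivWithin_le
    (f := fun z => exp z - exp a * z) (f' := fun z => exp z - exp a)
    (C := Real.exp a * (Real.exp ρ - 1))
    (fun x _ => ((hasDerivAt_exp x).sub (by simpa using (hasDerivAt_id x).const_mul (exp (a : ℂ)))).hasDerivWithinAt)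
    (fun x hx => norm_exp_sub_exp_le_of_norm_le (by simpa [dist_eq] using hx)) hw hz
  have h1 : ‖exp (a : ℂ)‖ = Real.exp a := by simp [norm_exp]
  have h2 : Real.exp a * (2 - Real.exp ρ) * ‖z - w‖ ≤ ‖exp z - exp w‖ := by
    have h3 : ‖exp (a : ℂ) * (z - w)‖ ≤ ‖exp z - exp w‖ +
        ‖(exp z - exp a * z) - (exp w - exp a * w)‖ := by
      have : exp (a : ℂ) * (z - w) = (exp z - exp w) -
        ((exp z - exp a * z) - (exp w - exp a * w)) := by ring
      rw [this]; exact norm_sub_le _ _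
    rw [norm_mul, h1] at h3
    nlinarith
  have h4 : Real.exp (-(3 * ρ)) ≤ 2 - Real.exp ρ := by
    set y := Real.exp ρ with hy
    have hy1 : 1 ≤ y := Real.one_le_exp hρ0
    have hy2 : y ≤ 1.7 := by
      have : y ^ 2 ≤ 2.89 := by
        rw [hy, ← Real.exp_nat_mul]
        calc Real.exp _ ≤ Real.exp 1 := Real.exp_le_exp.2 (by push_cast; linarith)
          _ ≤ _ := by linarith [Real.exp_one_lt_d9]
      nlinarith
    have h5 : Real.exp (-(3 * ρ)) = (y ^ 3)⁻¹ := by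
      rw [Real.exp_neg, hy, ← Real.exp_nat_mul]; norm_num
    rw [h5, inv_le_iff_one_le_mul₀ (by positivity)]
    nlinarith [mul_nonneg (sub_nonneg.2 hy1) (sub_nonneg.2 hy2),
      mul_nonneg (mul_nonneg (sub_nonneg.2 hy1) (sub_nonneg.2 hy2)) (by linarith : 0 ≤ y)]
  rw [dist_eq, dist_eq]
  have h6 : Real.exp (a - 3 * ρ) * ‖z - w‖ ≤ ‖exp z - exp w‖ := by
    refine le_trans ?_ h2
    rw [sub_eq_add_neg, Real.exp_add]
    gcongr
  calc ‖z - w‖ = Real.exp (3 * ρ - a) * (Real.exp (a - 3 * ρ) * ‖z - w‖) := by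
        rw [← mul_assoc, ← Real.exp_add]; simp
    _ ≤ _ := by gcongr

end Complex

/-! ### Vanishing content of slabs far to the right -/

namespace devaneyContinuum

theorem exp_mem {z : ℂ} (hz : z ∈ devaneyContinuum) : Complex.exp z ∈ devaneyContinuum :=
  fun n => by simpa only [Function.iterate_succ_apply] using hz (n + 1)

theorem iterate_mem {z : ℂ} (hz : z ∈ devaneyContinuum) (n : ℕ) :
    Complex.exp^[n] z ∈ devaneyContinuum := by
  induction n with
  | zero => exact hz
  | succ n ih => rw [Function.iterate_succ_apply']; exact exp_mem ih

theorem im_mem {z : ℂ} (hz : z ∈ devaneyContinuum) : z.im ∈ Icc 0 Real.pi := hz 0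

/-- The part of the set with real part in `[a, b]`. -/
def slab (a b : ℝ) : Set ℂ := devaneyContinuum ∩ Complex.re ⁻¹' Icc a b

theorem content_slab_le {s a b : ℝ} (hab : a ≤ b) {N : ℝ≥0∞}
    (hN : ∀ y ∈ Icc a b, hausdorffContent ℂ s (slab y (y + 1)) ≤ N) :
    hausdorffContent ℂ s (slab a b) ≤ ENNReal.ofReal (b - a + 1) * N := by
  have hsub : slab a b ⊆ ⋃ i ∈ Finset.range (⌊b - a⌋₊ + 1), slab (a + i) (a + i + 1) := by
    rintro z ⟨hz, hz1, hz2⟩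
    refine mem_biUnion (x := ⌊z.re - a⌋₊) ?_ ⟨hz, ?_, ?_⟩
    · simp only [Finset.coe_range, mem_Iio, Order.lt_add_one_iff]
      exact Nat.floor_le_floor (by linarith)
    · linarith [Nat.floor_le (sub_nonneg.2 hz1)]
    · linarith [Nat.lt_floor_add_one (z.re - a)]
  calc hausdorffContent ℂ s (slab a b)
      ≤ ∑ i ∈ Finset.range (⌊b - a⌋₊ + 1), hausdorffContent ℂ s (slab (a + i) (a + i + 1)) :=
        (measure_mono hsub).trans (measure_biUnion_finset_le _ _)
    _ ≤ ∑ i ∈ Finset.range (⌊b - a⌋₊ + 1), N := by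
        refine Finset.sum_le_sum fun i hi => hN _ ⟨by simp, ?_⟩
        have h1 : i ≤ ⌊b - a⌋₊ := Nat.lt_add_one_iff.1 (Finset.mem_range.1 hi)
        have h2 := (Nat.le_floor_iff (sub_nonneg.2 hab)).1 h1
        linarith
    _ ≤ _ := by
        rw [Finset.sum_const, Finset.card_range, nsmul_eq_mul]
        gcongr
        rw [← ENNReal.ofReal_natCast]
        refine ENNReal.ofReal_le_ofReal ?_
        push_cast
        linarith [Nat.floor_le (sub_nonneg.2 hab)]

/-- One step of the dynamics near a real point. -/
theorem content_inter_closedBall_le {s E ρ : ℝ} (hs : 0 ≤ s) (hρ0 : 0 < ρ) (hρ : ρ ≤ 1 / 2) :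
    hausdorffContent ℂ s (devaneyContinuum ∩ closedBall (E : ℂ) ρ) ≤
      ENNReal.ofReal ((Real.exp (4 * ρ) * ρ / (Real.exp E * (Real.exp ρ - 1))) ^ s) *
      hausdorffContent ℂ s (devaneyContinuum ∩
        closedBall ((Real.exp E : ℝ) : ℂ) (Real.exp E * (Real.exp ρ - 1))) := by
  have hE := Real.exp_pos E
  have h1 : 0 < Real.exp ρ - 1 := by linarith [Real.add_one_lt_exp hρ0.ne']
  refine hausdorffContent_le_image hs (by positivity) (f := Complex.exp) ?_ ?_
  · intro z hz w hw
    refine (Complex.dist_le_mul_dist_exp_of_mem_closedBall hρ hz.2 hw.2).trans ?_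
    gcongr
    have h2 : Real.exp ρ - 1 ≤ ρ * Real.exp ρ := by
      have := Real.add_one_le_exp (-ρ)
      have h3 : Real.exp (-ρ) * Real.exp ρ = 1 := by rw [← Real.exp_add]; simp
      nlinarith [Real.exp_pos ρ]
    have h4 : Real.exp (4 * ρ) = Real.exp (3 * ρ) * Real.exp ρ := by
      rw [← Real.exp_add]; ring_nf
    rw [Real.exp_sub, h4, div_le_div_iff₀ hE (by positivity)]
    calc Real.exp (3 * ρ) * (Real.exp E * (Real.exp ρ - 1))
        ≤ Real.exp (3 * ρ) * (Real.exp E * (ρ * Real.exp ρ)) := by gcongr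
      _ = _ := by ring
  · intro z hz
    refine ⟨exp_mem hz.1, ?_⟩
    have := Complex.norm_exp_sub_exp_le_of_norm_le (a := E) (by simpa [dist_eq_norm] using hz.2)
    simpa [dist_eq_norm] using this

theorem content_inter_closedBall_le_of_slab {s R E ρ : ℝ} {M : ℝ≥0∞}
    (hM : ∀ x, R ≤ x → hausdorffContent ℂ s (slab x (x + 1)) ≤ M)
    (hρ : 0 ≤ ρ) (hE : R ≤ E - ρ) :
    hausdorffContent ℂ s (devaneyContinuum ∩ closedBall (E : ℂ) ρ) ≤
      ENNReal.ofReal (2 * ρ + 1) * M := by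
  have : devaneyContinuum ∩ closedBall (E : ℂ) ρ ⊆ slab (E - ρ) (E + ρ) := by
    rintro z ⟨hz, hzE⟩
    refine ⟨hz, ?_⟩
    have h1 := (Complex.abs_re_le_norm (z - E)).trans (by simpa [dist_eq_norm] using hzE)
    rw [Complex.sub_re, Complex.ofReal_re, abs_le] at h1
    exact ⟨by linarith, by linarith⟩
  refine (measure_mono this).trans ((content_slab_le (by linarith)
    fun y hy => hM y (hE.trans hy.1)).trans_eq ?_)
  ring_nf

/-- Induction on the doublings left before the radius exceeds `1/2`. Since `ρ' ≥ 2ρ`, the weight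
`e^{-4ρ}` absorbs the distortion `e^{4ρ}` of each step. The invariant `ρ ≤ 2 r E³` persists because
`2E³ ≤ e^{2E}`; it guarantees that a disc which has become large is centred at least at `4R`. -/
theorem content_closedBall_le_of_small {s R r : ℝ} {M : ℝ≥0∞} (hs1 : 1 ≤ s) (hs2 : s ≤ 2)
    (hR : 1 ≤ R) (hr0 : 0 < r) (hr : 256 * R ^ 3 * r ≤ 1)
    (hM : ∀ x, R ≤ x → hausdorffContent ℂ s (slab x (x + 1)) ≤ M) (n : ℕ) :
    ∀ E ρ : ℝ, 1 ≤ E → 0 < ρ → ρ ≤ 1 / 2 → 1 / 2 < 2 ^ n * ρ → ρ ≤ 2 * r * E ^ 3 →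
    hausdorffContent ℂ s (devaneyContinuum ∩ closedBall (E : ℂ) ρ) ≤
      ENNReal.ofReal (8 * Real.exp 8 * (ρ * Real.exp (-(4 * ρ))) ^ s) * M := by
  induction n with
  | zero => intro E ρ _ _ h1 h2; exact absurd h2 (by simpa using h1)
  | succ n ih =>
    intro E ρ hE hρ0 hρ hn hinv
    refine (content_inter_closedBall_le (E := E) (by linarith) hρ0 hρ).trans ?_
    have hEE : 2 ≤ Real.exp E := by linarith [Real.add_one_le_exp E]
    have hE' := Real.exp_pos E
    have hρ1 := Real.add_one_le_exp ρ
    set E' := Real.exp E with hE'_def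
    have hy1 : Real.exp ρ ≤ 1.75 := by
      have : Real.exp ρ ^ 2 ≤ 2.89 := by
        rw [← Real.exp_nat_mul]
        calc Real.exp _ ≤ Real.exp 1 := Real.exp_le_exp.2 (by push_cast; linarith)
          _ ≤ _ := by linarith [Real.exp_one_lt_d9]
      nlinarith
    have h2 : Real.exp ρ - 1 ≤ ρ * Real.exp ρ := by
      have := Real.add_one_le_exp (-ρ)
      have h3 : Real.exp (-ρ) * Real.exp ρ = 1 := by rw [← Real.exp_add]; simp
      nlinarith [Real.exp_pos ρ]
    set ρ' := E' * (Real.exp ρ - 1) with hρ'_def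
    have hρρ' : 2 * ρ ≤ ρ' := by nlinarith
    have hρ'0 : 0 < ρ' := by linarith
    have hinv' : ρ' ≤ 2 * r * E' ^ 3 := by
      have h4 : 2 * E ^ 3 ≤ E' ^ 2 := by
        have h5 := Real.quadratic_le_exp_of_nonneg (by linarith : 0 ≤ E)
        have h6 : (1 + E + E ^ 2 / 2) ^ 2 ≤ E' ^ 2 := by gcongr
        nlinarith [sq_nonneg (E * (E - 2)), sq_nonneg E]
      have h7 : ρ' ≤ E' * (2 * ρ) := by
        rw [hρ'_def]; gcongr; nlinarith
      have h8 : r * (2 * E ^ 3) ≤ r * E' ^ 2 := by gcongr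
      nlinarith
    rcases le_or_gt ρ' (1 / 2) with hle | hgt
    · have h9 := ih E' ρ' (by linarith) hρ'0 hle (by rw [pow_succ] at hn; nlinarith [pow_pos (two_pos : (0:ℝ) < 2) n]) hinv'
      refine (mul_le_mul_right h9 _).trans ?_
      rw [← mul_assoc, ← ENNReal.ofReal_mul (by positivity)]
      gcongr ENNReal.ofReal ?_ * _
      rw [mul_left_comm, ← Real.mul_rpow (by positivity) (by positivity)]
      gcongr _ * ?_ ^ s
      calc Real.exp (4 * ρ) * ρ / ρ' * (ρ' * Real.exp (-(4 * ρ')))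
          = ρ * (Real.exp (4 * ρ) * Real.exp (-(4 * ρ'))) := by field_simp
        _ = ρ * Real.exp (4 * ρ - 4 * ρ') := by rw [← Real.exp_add]; ring_nf
        _ ≤ _ := by gcongr; linarith
    · have h10 : 4 * R ≤ E' := by
        have : (4 * R) ^ 3 ≤ E' ^ 3 := by
          have : 0 < 4 * r := by linarith
          refine le_of_mul_le_mul_left ?_ this
          nlinarith
        exact (pow_le_pow_iff_left₀ (by positivity) hE'.le three_ne_zero).1 this
      -- As `e^ρ - 1 ≤ 3/4`, the disc stays to the right of `E' / 4 ≥ R`.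
      have h11 := content_inter_closedBall_le_of_slab (E := E') hM hρ'0.le
        (by rw [hρ'_def]; nlinarith)
      refine (mul_le_mul_right h11 _).trans ?_
      rw [← mul_assoc, ← ENNReal.ofReal_mul (by positivity)]
      gcongr ENNReal.ofReal ?_ * _
      have h12 : 2 * ρ' + 1 ≤ 8 * ρ' ^ s := by
        have h13 : (1 / 2 : ℝ) ≤ ρ' ^ (s - 1) := by
          calc (1 / 2 : ℝ) = (1 / 2 : ℝ) ^ (1 : ℝ) := by simp
            _ ≤ (1 / 2 : ℝ) ^ (s - 1) :=
              Real.rpow_le_rpow_of_exponent_ge (by norm_num) (by norm_num) (by linarith)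
            _ ≤ _ := by gcongr
        have h14 : ρ' ^ s = ρ' ^ (s - 1) * ρ' := by
          rw [← Real.rpow_add_one hρ'0.ne']; ring_nf
        rw [h14]; nlinarith
      have h15 : (Real.exp (4 * ρ) * ρ) ^ s ≤ Real.exp 8 * (ρ * Real.exp (-(4 * ρ))) ^ s := by
        have : Real.exp (4 * ρ) * ρ = Real.exp (8 * ρ) * (ρ * Real.exp (-(4 * ρ))) := by
          rw [mul_left_comm, ← Real.exp_add]; ring_nf
        rw [this, Real.mul_rpow (by positivity) (by positivity), ← Real.exp_mul]
        gcongr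
        nlinarith
      rw [Real.div_rpow (by positivity) hρ'0.le]
      have h16 := Real.rpow_pos_of_pos hρ'0 s
      calc (Real.exp (4 * ρ) * ρ) ^ s / ρ' ^ s * (2 * ρ' + 1)
          ≤ (Real.exp (4 * ρ) * ρ) ^ s / ρ' ^ s * (8 * ρ' ^ s) := by gcongr
        _ = 8 * (Real.exp (4 * ρ) * ρ) ^ s := by field_simp
        _ ≤ 8 * (Real.exp 8 * (ρ * Real.exp (-(4 * ρ))) ^ s) := by gcongr
        _ = _ := by ring

/-- Near the origin the content is controlled by the content of the slabs far to the right. -/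
theorem content_closedBall_zero_le {s R r : ℝ} {M : ℝ≥0∞} (hs1 : 1 ≤ s) (hs2 : s ≤ 2)
    (hR : 1 ≤ R) (hr0 : 0 < r) (hr : 256 * R ^ 3 * r ≤ 1)
    (hM : ∀ x, R ≤ x → hausdorffContent ℂ s (slab x (x + 1)) ≤ M) :
    hausdorffContent ℂ s (devaneyContinuum ∩ closedBall 0 r) ≤
      ENNReal.ofReal (8 * Real.exp 8 * r ^ s) * M := by
  have hr' : r ≤ 1 / 256 := by nlinarith [one_le_pow₀ hR (n := 3)]
  have h0 := content_inter_closedBall_le (s := s) (E := 0) (by linarith) hr0 (by linarith)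
  have h1 := Real.add_one_lt_exp hr0.ne'
  have h2 : Real.exp r - 1 ≤ 2 * r := by
    have := Real.abs_exp_sub_one_le (x := r) (by rw [abs_of_pos hr0]; linarith)
    rw [abs_of_pos hr0] at this
    exact (le_abs_self _).trans this
  simp only [Complex.ofReal_zero, Real.exp_zero, one_mul] at h0
  obtain ⟨n, hn⟩ := pow_unbounded_of_one_lt (1 / 2 / (Real.exp r - 1)) (one_lt_two (α := ℝ))
  -- After one step the centre `0` has moved to `1`, and `e^r - 1 ≤ 2r` is the invariant at `E = 1`.
  have h3 := content_closedBall_le_of_small hs1 hs2 hR hr0 hr hM n 1 (Real.exp r - 1) le_rfl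
    (by linarith) (by linarith) ((div_lt_iff₀ (by linarith)).1 hn) (by linarith)
  refine h0.trans ((mul_le_mul_right h3 _).trans ?_)
  set ρ' := Real.exp r - 1
  have hρ' : 0 < ρ' := by simp only [ρ']; linarith
  rw [← mul_assoc, ← ENNReal.ofReal_mul (by positivity)]
  gcongr ENNReal.ofReal ?_ * _
  rw [mul_left_comm, ← Real.mul_rpow (by positivity) (by positivity)]
  gcongr _ * ?_ ^ s
  calc Real.exp (4 * r) * r / ρ' * (ρ' * Real.exp (-(4 * ρ')))
      = r * (Real.exp (4 * r) * Real.exp (-(4 * ρ'))) := by field_simp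
    _ = r * Real.exp (4 * r - 4 * ρ') := by rw [← Real.exp_add]; ring_nf
    _ ≤ r * Real.exp 0 := by gcongr; linarith
    _ = r := by simp

theorem content_slab_le_mul {s x : ℝ} (hs : 0 ≤ s) {B : Set ℂ}
    (hB : MapsTo Complex.exp (slab x (x + 1)) B) :
    hausdorffContent ℂ s (slab x (x + 1)) ≤
      ENNReal.ofReal ((2 * Real.exp (-x)) ^ s) * hausdorffContent ℂ s B :=
  hausdorffContent_le_image hs (by positivity) (fun _ hz _ hw =>
    Complex.dist_le_mul_dist_exp hz.2.1 hw.2.1 (im_mem hz.1) (im_mem hw.1)) hB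

theorem content_slab_neg_le {s R x : ℝ} {M : ℝ≥0∞} (hs1 : 1 ≤ s) (hs2 : s ≤ 2)
    (hR : 1 ≤ R) (hR' : 256 * R ^ 3 * Real.exp 1 ≤ Real.exp R) (hx : x ≤ -R)
    (hM : ∀ x, R ≤ x → hausdorffContent ℂ s (slab x (x + 1)) ≤ M) :
    hausdorffContent ℂ s (slab x (x + 1)) ≤ ENNReal.ofReal (8 * Real.exp 8 * 36) * M := by
  have hmaps : MapsTo Complex.exp (slab x (x + 1))
      (devaneyContinuum ∩ closedBall 0 (Real.exp (x + 1))) := fun z hz =>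
    ⟨exp_mem hz.1, by simpa [dist_eq_norm, Complex.norm_exp] using hz.2.2⟩
  refine (content_slab_le_mul (by linarith) hmaps).trans ?_
  have h := content_closedBall_zero_le hs1 hs2 hR (Real.exp_pos (x + 1)) ?_ hM
  · refine (mul_le_mul_right h _).trans ?_
    rw [← mul_assoc, ← ENNReal.ofReal_mul (by positivity)]
    gcongr ENNReal.ofReal ?_ * _
    rw [mul_left_comm, ← Real.mul_rpow (by positivity) (by positivity)]
    gcongr _ * ?_
    have h1 : 2 * Real.exp (-x) * Real.exp (x + 1) = 2 * Real.exp 1 := by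
      rw [mul_assoc, ← Real.exp_add]; ring_nf
    rw [h1]
    have h2 : 2 * Real.exp 1 ≤ 6 := by linarith [Real.exp_one_lt_d9]
    calc (2 * Real.exp 1) ^ s ≤ (6 : ℝ) ^ s := by gcongr
      _ ≤ (6 : ℝ) ^ (2 : ℝ) := Real.rpow_le_rpow_of_exponent_le (by norm_num) hs2
      _ = 36 := by norm_num
  · rw [Real.exp_add]
    have h3 : Real.exp x ≤ Real.exp (-R) := Real.exp_le_exp.2 hx
    have h4 : Real.exp R * Real.exp (-R) = 1 := by rw [← Real.exp_add]; simp
    calc 256 * R ^ 3 * (Real.exp x * Real.exp 1) = (256 * R ^ 3 * Real.exp 1) * Real.exp x := by ring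
      _ ≤ Real.exp R * Real.exp (-R) := by gcongr
      _ = 1 := h4

theorem content_slab_pos_le {s R x : ℝ} {M : ℝ≥0∞} (hs1 : 1 ≤ s) (hs2 : s ≤ 2)
    (hR : 1 ≤ R) (hR' : 256 * R ^ 3 * Real.exp 1 ≤ Real.exp R) (hRpi : R + 4 ≤ Real.exp R)
    (hx : R ≤ x) (hM : ∀ x, R ≤ x → hausdorffContent ℂ s (slab x (x + 1)) ≤ M) :
    hausdorffContent ℂ s (slab x (x + 1)) ≤
      ENNReal.ofReal (24 * (1 + 8 * Real.exp 8 * 36) * Real.exp (-((s - 1) * R))) * M := by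
  set C := 8 * Real.exp 8 * 36
  have hC : 0 ≤ C := by positivity
  -- Heights in the strip are at most `π ≤ 4`, so `|Re|` differs from the modulus by at most `4`.
  set a := Real.exp x - 4
  set b := Real.exp (x + 1)
  have hxR : Real.exp R ≤ Real.exp x := Real.exp_le_exp.2 hx
  have hRa : R ≤ a := by simp only [a]; linarith
  have hab : a ≤ b := by
    have : Real.exp x ≤ b := Real.exp_le_exp.2 (by linarith)
    simp only [a]; linarith
  have hmaps : MapsTo Complex.exp (slab x (x + 1)) (slab a b ∪ slab (-b) (-a)) := by
    intro z hz
    have hF := exp_mem hz.1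
    have him := im_mem hF
    have hn : ‖Complex.exp z‖ = Real.exp z.re := Complex.norm_exp z
    have h1 : Real.exp x ≤ ‖Complex.exp z‖ := hn ▸ Real.exp_le_exp.2 hz.2.1
    have h2 : ‖Complex.exp z‖ ≤ b := hn ▸ Real.exp_le_exp.2 hz.2.2
    have h3 := Complex.norm_le_abs_re_add_abs_im (Complex.exp z)
    have h4 := Complex.abs_re_le_norm (Complex.exp z)
    rw [abs_of_nonneg him.1] at h3
    have h5 : a ≤ |(Complex.exp z).re| := by
      simp only [a]; linarith [him.2, Real.pi_le_four]
    rcases abs_cases (Complex.exp z).re with h | h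
    · exact Or.inl ⟨hF, by linarith, by linarith⟩
    · exact Or.inr ⟨hF, by linarith, by linarith⟩
  refine (content_slab_le_mul (by linarith) hmaps).trans ?_
  have hp := content_slab_le (s := s) hab fun y hy => hM y (hRa.trans hy.1)
  have hn := content_slab_le (s := s) (neg_le_neg hab) fun y hy =>
    content_slab_neg_le hs1 hs2 hR hR' (by linarith [hy.2]) hM
  have hu : hausdorffContent ℂ s (slab a b ∪ slab (-b) (-a)) ≤
      ENNReal.ofReal ((b - a + 1) * (1 + C)) * M := by
    refine (measure_union_le _ _).trans ((add_le_add hp hn).trans_eq ?_)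
    rw [← mul_assoc, ← ENNReal.ofReal_mul (by linarith), ← add_mul,
      ← ENNReal.ofReal_add (by linarith) (mul_nonneg (by linarith) hC)]
    congr 2; ring
  refine (mul_le_mul_right hu _).trans ?_
  rw [← mul_assoc, ← ENNReal.ofReal_mul (by positivity)]
  gcongr ENNReal.ofReal ?_ * _
  have h6 : b - a + 1 ≤ 6 * Real.exp x := by
    have h7 : b = Real.exp x * Real.exp 1 := by simp only [b]; rw [Real.exp_add]
    have h8 := Real.exp_one_lt_d9
    have h9 : (5 : ℝ) ≤ Real.exp x := by linarith
    simp only [a]; rw [h7]; nlinarith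
  have h10 : (2 * Real.exp (-x)) ^ s ≤ 4 * Real.exp (-(x * s)) := by
    rw [Real.mul_rpow (by norm_num) (by positivity), ← Real.exp_mul]
    have : (2 : ℝ) ^ s ≤ 4 := by
      calc (2 : ℝ) ^ s ≤ (2 : ℝ) ^ (2 : ℝ) := Real.rpow_le_rpow_of_exponent_le (by norm_num) hs2
        _ = 4 := by norm_num
    rw [neg_mul]; gcongr
  calc (2 * Real.exp (-x)) ^ s * ((b - a + 1) * (1 + C))
      ≤ 4 * Real.exp (-(x * s)) * ((6 * Real.exp x) * (1 + C)) := by gcongr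
    _ = 24 * (1 + C) * (Real.exp (-(x * s)) * Real.exp x) := by ring
    _ = 24 * (1 + C) * Real.exp (-((s - 1) * x)) := by rw [← Real.exp_add]; ring_nf
    _ ≤ _ := by gcongr

theorem ediam_slab_le (x : ℝ) : ediam (slab x (x + 1)) ≤ ENNReal.ofReal 5 := by
  refine ediam_le_of_forall_dist_le fun z hz w hw => ?_
  rw [Complex.dist_eq]
  refine (Complex.norm_le_abs_re_add_abs_im _).trans ?_
  have h1 : |(z - w).re| ≤ 1 := by
    rw [Complex.sub_re, abs_le]
    constructor <;> linarith [hz.2.1, hz.2.2, hw.2.1, hw.2.2]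
  have h2 : |(z - w).im| ≤ 4 := by
    rw [Complex.sub_im, abs_le]
    constructor <;> linarith [(im_mem hz.1).1, (im_mem hz.1).2, (im_mem hw.1).1, (im_mem hw.1).2,
      Real.pi_le_four]
  linarith

theorem exists_content_slab_eq_zero {s : ℝ} (hs1 : 1 < s) (hs2 : s ≤ 2) :
    ∃ R : ℝ, ∀ x, R ≤ x → hausdorffContent ℂ s (slab x (x + 1)) = 0 := by
  have e1 : ∀ᶠ R : ℝ in atTop, 256 * R ^ 3 * Real.exp 1 ≤ Real.exp R := by
    have h := (Real.tendsto_pow_mul_exp_neg_atTop_nhds_zero 3).const_mul (256 * Real.exp 1)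
    rw [mul_zero] at h
    filter_upwards [h.eventually_le_const one_pos] with R hR
    rw [Real.exp_neg] at hR
    have := Real.exp_pos R
    calc 256 * R ^ 3 * Real.exp 1 = 256 * Real.exp 1 * (R ^ 3 * (Real.exp R)⁻¹) * Real.exp R := by
          field_simp
      _ ≤ 1 * Real.exp R := by gcongr
      _ = _ := one_mul _
  have e2 : ∀ᶠ R : ℝ in atTop,
      24 * (1 + 8 * Real.exp 8 * 36) * Real.exp (-((s - 1) * R)) ≤ 1 / 2 := by
    have h : Tendsto (fun R : ℝ => Real.exp (-((s - 1) * R))) atTop (𝓝 0) :=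
      Real.tendsto_exp_neg_atTop_nhds_zero.comp
        (tendsto_id.const_mul_atTop (by linarith : 0 < s - 1))
    have h := h.const_mul (24 * (1 + 8 * Real.exp 8 * 36))
    rw [mul_zero] at h
    exact h.eventually_le_const (by norm_num)
  obtain ⟨R, h1, h2, hR⟩ := (e1.and (e2.and (eventually_ge_atTop (4 : ℝ)))).exists
  refine ⟨R, ?_⟩
  set M := ⨆ (x : ℝ) (_ : R ≤ x), hausdorffContent ℂ s (slab x (x + 1))
  have hM : ∀ x, R ≤ x → hausdorffContent ℂ s (slab x (x + 1)) ≤ M := fun x hx =>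
    le_iSup₂ (f := fun (x : ℝ) (_ : R ≤ x) => hausdorffContent ℂ s (slab x (x + 1))) x hx
  have hfin : M ≠ ∞ := by
    refine ne_top_of_le_ne_top (b := ENNReal.ofReal 5 ^ s)
      (ENNReal.rpow_ne_top_of_nonneg (by linarith) ENNReal.ofReal_ne_top)
      (iSup₂_le fun x _ => (hausdorffContent_le_ediam s _).trans ?_)
    exact ENNReal.rpow_le_rpow (ediam_slab_le x) (by linarith)
  have hpi : R + 4 ≤ Real.exp R := by
    have := Real.quadratic_le_exp_of_nonneg (by linarith : 0 ≤ R)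
    nlinarith
  have hhalf : M ≤ ENNReal.ofReal (1 / 2) * M := iSup₂_le fun x hx =>
    (content_slab_pos_le hs1.le hs2 (by linarith) h1 hpi hx hM).trans (by gcongr)
  have hM0 : M = 0 := by
    by_contra hne
    have hlt : ENNReal.ofReal (1 / 2) * M < 1 * M :=
      ENNReal.mul_lt_mul_left hne hfin (by rw [ENNReal.ofReal_lt_one]; norm_num)
    rw [one_mul] at hlt
    exact absurd hhalf hlt.not_ge
  exact fun x hx => le_antisymm ((hM x hx).trans hM0.le) bot_le

end devaneyContinuum

/-! ### Expansion in the hyperbolic metric -/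

theorem Real.mul_sin_le_mul_sin {u v : ℝ} (hu : 0 ≤ u) (huv : u ≤ v) (hv : v ≤ Real.pi) :
    u * Real.sin v ≤ v * Real.sin u := by
  rcases hu.eq_or_lt with rfl | hu
  · simp
  have hv0 : 0 < v := hu.trans_le huv
  have h := strictConcaveOn_sin_Icc.concaveOn.2
    (⟨le_rfl, Real.pi_pos.le⟩ : (0 : ℝ) ∈ Icc 0 Real.pi) (⟨hv0.le, hv⟩ : v ∈ Icc 0 Real.pi)
    (sub_nonneg.2 ((div_le_one hv0).2 huv)) (by positivity) (sub_add_cancel 1 (u / v))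
  simp only [smul_eq_mul, mul_zero, Real.sin_zero, zero_add] at h
  rw [div_mul_cancel₀ _ hv0.ne', div_mul_eq_mul_div, div_le_iff₀ hv0] at h
  linarith

/-- In half-angles this combines the monotonicity of `sin u / u` with `y / 2 ≤ tan (y / 2)`. -/
theorem Real.sub_sq_mul_sin_le {y y' : ℝ} (hy' : 0 ≤ y') (hyy : y' ≤ y) (hy : y < Real.pi) :
    (y - y') ^ 2 * Real.sin y ≤ 2 * (1 - Real.cos (y - y')) * y := by
  rcases (hy'.trans hyy).eq_or_lt with h0 | hy0
  · simp [← h0]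
  set b := y - y'
  have hb0 : 0 ≤ b := sub_nonneg.2 hyy
  have hby : b ≤ y := by simp only [b]; linarith
  have h1 : b / 2 * Real.sin (y / 2) ≤ y / 2 * Real.sin (b / 2) :=
    Real.mul_sin_le_mul_sin (by linarith) (by linarith) (by linarith)
  have hs : 0 < Real.sin (y / 2) := Real.sin_pos_of_pos_of_lt_pi (by linarith) (by linarith)
  have hc : 0 < Real.cos (y / 2) := Real.cos_pos_of_mem_Ioo ⟨by linarith, by linarith⟩
  have h2 : y / 2 * Real.cos (y / 2) ≤ Real.sin (y / 2) := by
    have := Real.le_tan (by linarith : 0 ≤ y / 2) (by linarith)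
    rwa [Real.tan_eq_sin_div_cos, le_div_iff₀ hc] at this
  have h3 : Real.sin y = 2 * Real.sin (y / 2) * Real.cos (y / 2) := by
    rw [← Real.sin_two_mul]; ring_nf
  have h4 : 1 - Real.cos b = 2 * Real.sin (b / 2) ^ 2 := by
    have := Real.cos_two_mul (b / 2)
    have h5 := Real.sin_sq_add_cos_sq (b / 2)
    rw [mul_div_cancel₀ _ (two_ne_zero)] at this
    linarith
  rw [h3, h4]
  have h6 : (b * Real.sin (y / 2)) ^ 2 ≤ (y * Real.sin (b / 2)) ^ 2 :=
    pow_le_pow_left₀ (by positivity) (by linarith) 2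
  refine le_of_mul_le_mul_right ?_ hy0
  calc b ^ 2 * (2 * Real.sin (y / 2) * Real.cos (y / 2)) * y
      = 4 * (b ^ 2 * Real.sin (y / 2)) * (y / 2 * Real.cos (y / 2)) := by ring
    _ ≤ 4 * (b ^ 2 * Real.sin (y / 2)) * Real.sin (y / 2) := by gcongr
    _ = 4 * (b * Real.sin (y / 2)) ^ 2 := by ring
    _ ≤ 4 * (y * Real.sin (b / 2)) ^ 2 := by gcongr
    _ = _ := by ring

namespace Complex

/-- Quantitative expansion of `exp` for the hyperbolic metric of the upper half-plane. -/
theorem normSq_mul_im_exp_le {δ : ℝ} (hδ : 0 < δ) {z w : ℂ} (hz : δ ≤ z.im) (hw : δ ≤ w.im)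
    (hz' : z.im < Real.pi) (hw' : w.im < Real.pi) :
    normSq (z - w) * ((exp z).im * (exp w).im) ≤
      Real.sin δ / δ * (normSq (exp z - exp w) * (z.im * w.im)) := by
  wlog h : w.im ≤ z.im generalizing z w
  · have := this hw hz hw' hz' (le_of_not_ge h)
    rw [← normSq_neg (z - w), ← normSq_neg (exp z - exp w), neg_sub, neg_sub, mul_comm z.im,
      mul_comm (exp z).im]
    exact this
  have hz0 : 0 < z.im := hδ.trans_le hz
  have hw0 : 0 < w.im := hδ.trans_le hw
  have hsz := Real.sin_pos_of_pos_of_lt_pi hz0 hz'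
  have hsw := Real.sin_pos_of_pos_of_lt_pi hw0 hw'
  set q := Real.sin δ / δ
  have hq : Real.sin w.im ≤ q * w.im := by
    have := Real.mul_sin_le_mul_sin hδ.le hw hw'.le
    simp only [q]
    rw [div_mul_eq_mul_div, le_div_iff₀ hδ]; linarith
  have hzz : Real.sin z.im ≤ z.im := Real.sin_le hz0.le
  have h1 := Real.sub_sq_mul_sin_le hw0.le h hz'
  have hez := Real.exp_pos z.re
  have hew := Real.exp_pos w.re
  have h2 : Real.exp z.re * Real.exp w.re * (z.re - w.re) ^ 2 ≤
      (Real.exp z.re - Real.exp w.re) ^ 2 := by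
    have key : ∀ t : ℝ, 0 ≤ t → Real.exp t * (2 * t) ^ 2 * Real.exp t ≤
        (Real.exp (2 * t) - 1) ^ 2 := by
      intro t ht
      have h3 := Real.self_le_sinh_iff.2 ht
      rw [Real.sinh_eq, Real.exp_neg] at h3
      have h5 : Real.exp (2 * t) = Real.exp t * Real.exp t := by rw [← Real.exp_add]; ring_nf
      have h4 : 2 * t * Real.exp t ≤ Real.exp (2 * t) - 1 := by
        rw [h5]
        have := Real.exp_pos t
        have h6 : (Real.exp t)⁻¹ * Real.exp t = 1 := inv_mul_cancel₀ this.ne'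
        nlinarith
      calc _ = (2 * t * Real.exp t) ^ 2 := by ring
        _ ≤ _ := pow_le_pow_left₀ (by positivity) h4 2
    have key2 : ∀ p r : ℝ, r ≤ p →
        Real.exp p * Real.exp r * (p - r) ^ 2 ≤ (Real.exp p - Real.exp r) ^ 2 := by
      intro p r hpr
      have h3 := key ((p - r) / 2) (by linarith)
      rw [mul_div_cancel₀ _ (two_ne_zero), mul_right_comm, ← Real.exp_add, add_halves] at h3
      have h4 : Real.exp p = Real.exp r * Real.exp (p - r) := by rw [← Real.exp_add]; ring_nf
      rw [h4]
      calc _ = Real.exp r ^ 2 * (Real.exp (p - r) * (p - r) ^ 2) := by ring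
        _ ≤ Real.exp r ^ 2 * (Real.exp (p - r) - 1) ^ 2 := by gcongr
        _ = _ := by ring
    rcases le_total w.re z.re with h | h
    · exact key2 _ _ h
    · have := key2 _ _ h
      nlinarith
  rw [normSq_exp_sub_exp, exp_im, exp_im, normSq_apply, sub_re, sub_im]
  have hq0 : 0 < q := pos_of_mul_pos_left (hsw.trans_le hq) hw0.le
  have h7 : (z.re - w.re) ^ 2 * (Real.sin z.im * Real.sin w.im) ≤
      (z.re - w.re) ^ 2 * (z.im * (q * w.im)) := by gcongr
  -- The angular term uses up the sine of the higher point in `h1`; the sine of the lower one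
  -- supplies the gain `q`.
  have h8 : (z.im - w.im) ^ 2 * Real.sin z.im * Real.sin w.im ≤
      2 * (1 - Real.cos (z.im - w.im)) * z.im * (q * w.im) := by
    refine mul_le_mul h1 hq hsw.le ?_
    have := Real.cos_le_one (z.im - w.im)
    exact mul_nonneg (by linarith) hz0.le
  have h9 := mul_le_mul_of_nonneg_right h2 (by positivity : 0 ≤ q * (z.im * w.im))
  have h10 := mul_le_mul_of_nonneg_left (add_le_add h7 h8)
    (by positivity : 0 ≤ Real.exp z.re * Real.exp w.re)
  nlinarith

end Complex

/-! ### Orbits that stay in a left half-plane -/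

namespace devaneyContinuum

theorem iterate_exp_ofReal (n : ℕ) (x : ℝ) :
    Complex.exp^[n] (x : ℂ) = ((Real.exp^[n] x : ℝ) : ℂ) := by
  induction n generalizing x with
  | zero => rfl
  | succ n ih => rw [Function.iterate_succ_apply, Function.iterate_succ_apply, ← ih,
      Complex.ofReal_exp]

theorem ofReal_mem (x : ℝ) : (x : ℂ) ∈ devaneyContinuum := fun n => by
  rw [iterate_exp_ofReal, Complex.ofReal_im]
  exact ⟨le_rfl, Real.pi_pos.le⟩

theorem le_iterate_exp (x : ℝ) (k : ℕ) : (k : ℝ) ≤ Real.exp^[k + 1] x := by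
  induction k with
  | zero => simpa using (Real.exp_pos x).le
  | succ k ih =>
    rw [Function.iterate_succ_apply']
    push_cast
    linarith [Real.add_one_le_exp (Real.exp^[k + 1] x)]

/-- Uniformity over the unbounded ray `x ≤ R` holds because `|exp'| ≤ e^R` there and `exp` maps it
into the ray ending at `e^R`. -/
theorem exists_norm_iterate_exp_sub_lt (k : ℕ) :
    ∀ R ε : ℝ, 0 < ε → ∃ δ, 0 < δ ∧ ∀ (x : ℝ) (w : ℂ), x ≤ R → ‖w - x‖ ≤ δ →
      ‖Complex.exp^[k] w - (Real.exp^[k] x : ℝ)‖ < ε := by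
  induction k with
  | zero =>
    intro R ε hε
    exact ⟨ε / 2, by linarith, fun x w _ hw => by
      simp only [Function.iterate_zero, id_eq]; linarith⟩
  | succ k ih =>
    intro R ε hε
    obtain ⟨δ, hδ, h⟩ := ih (Real.exp R) ε hε
    have hR := Real.exp_pos R
    refine ⟨min 1 (δ / (2 * Real.exp R)), by positivity, fun x w hx hw => ?_⟩
    rw [Function.iterate_succ_apply, Function.iterate_succ_apply]
    refine h _ _ (Real.exp_le_exp.2 hx) ?_
    rw [Complex.ofReal_exp]
    set η := min 1 (δ / (2 * Real.exp R))
    have hη : 0 < η := by positivity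
    have h1 : Real.exp η - 1 ≤ 2 * η := by
      have := Real.abs_exp_sub_one_le (x := η) (by rw [abs_of_pos hη]; exact min_le_left _ _)
      rw [abs_of_pos hη] at this
      exact (le_abs_self _).trans this
    have h2 : η ≤ δ / (2 * Real.exp R) := min_le_right _ _
    calc _ ≤ Real.exp x * (Real.exp η - 1) := Complex.norm_exp_sub_exp_le_of_norm_le hw
      _ ≤ Real.exp R * (2 * η) := by
        refine mul_le_mul (Real.exp_le_exp.2 hx) h1 ?_ hR.le
        linarith [Real.add_one_le_exp η]
      _ ≤ Real.exp R * (2 * (δ / (2 * Real.exp R))) := by gcongr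
      _ = δ := by field_simp

/-- The points whose orbit stays in the half-plane `Re < R`. -/
def bddOrbits (R : ℝ) : Set ℂ := {z ∈ devaneyContinuum | ∀ n, (Complex.exp^[n] z).re < R}

theorem exp_mem_bddOrbits {R : ℝ} {z : ℂ} (hz : z ∈ bddOrbits R) :
    Complex.exp z ∈ bddOrbits R :=
  ⟨exp_mem hz.1, fun n => by simpa only [Function.iterate_succ_apply] using hz.2 (n + 1)⟩

theorem iterate_mem_bddOrbits {R : ℝ} {z : ℂ} (hz : z ∈ bddOrbits R) (n : ℕ) :
    Complex.exp^[n] z ∈ bddOrbits R := by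
  induction n with
  | zero => exact hz
  | succ n ih => rw [Function.iterate_succ_apply']; exact exp_mem_bddOrbits ih

/-- A point too close to the real axis shadows the orbit of its real part, which passes `R + 1`
within a number of steps independent of the starting point. -/
theorem exists_le_im_of_mem_bddOrbits (R : ℝ) :
    ∃ δ, 0 < δ ∧ ∀ z ∈ bddOrbits R, δ ≤ z.im := by
  obtain ⟨k, hk⟩ := exists_nat_ge (R + 1)
  obtain ⟨δ, hδ, h⟩ := exists_norm_iterate_exp_sub_lt (k + 1) R 1 one_pos
  refine ⟨δ, hδ, fun z hz => ?_⟩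
  by_contra! hlt
  have h1 := h z.re z (hz.2 0).le (by
    have : z - z.re = z.im * Complex.I := by
      apply Complex.ext <;> simp
    rw [this, norm_mul, Complex.norm_I, mul_one, Complex.norm_real, Real.norm_eq_abs,
      abs_of_nonneg (im_mem hz.1).1]
    exact hlt.le)
  have h2 := (Complex.abs_re_le_norm _).trans_lt h1
  rw [Complex.sub_re, Complex.ofReal_re, abs_lt] at h2
  linarith [hz.2 (k + 1), le_iterate_exp z.re k]

theorem im_lt_pi_of_exp_im_pos {z : ℂ} (hz : z ∈ devaneyContinuum)
    (h : 0 < (Complex.exp z).im) : z.im < Real.pi := by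
  refine lt_of_le_of_ne (im_mem hz).2 fun heq => ?_
  rw [Complex.exp_im, heq, Real.sin_pi, mul_zero] at h
  exact lt_irrefl _ h

/-- The quantity `|z - w|² / (Im z · Im w)`, a function of hyperbolic distance, grows by at least `δ
/ sin δ > 1` at each step yet stays bounded on this set, so it vanishes. -/
theorem subsingleton_bddOrbits (R : ℝ) : (bddOrbits R).Subsingleton := by
  obtain ⟨δ, hδ, him⟩ := exists_le_im_of_mem_bddOrbits R
  have hpi : ∀ z ∈ bddOrbits R, z.im < Real.pi := fun z hz =>
    im_lt_pi_of_exp_im_pos hz.1 (hδ.trans_le (him _ (exp_mem_bddOrbits hz)))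
  have hre : ∀ z ∈ bddOrbits R, Real.log δ ≤ z.re := by
    intro z hz
    rw [Real.log_le_iff_le_exp hδ, ← Complex.norm_exp]
    exact (him _ (exp_mem_bddOrbits hz)).trans ((le_abs_self _).trans (Complex.abs_im_le_norm _))
  set K := (R - Real.log δ) ^ 2 + Real.pi ^ 2
  have hK : ∀ z ∈ bddOrbits R, ∀ w ∈ bddOrbits R, Complex.normSq (z - w) ≤ K := by
    intro z hz w hw
    rw [Complex.normSq_apply, ← sq, ← sq, Complex.sub_re, Complex.sub_im]
    have h1 : z.re < R := hz.2 0
    have h2 : w.re < R := hw.2 0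
    refine add_le_add (sq_le_sq' ?_ ?_) (sq_le_sq' ?_ ?_) <;>
      linarith [hre z hz, hre w hw, him z hz, him w hw, hpi z hz, hpi w hw]
  intro z hz w hw
  set q := Real.sin δ / δ
  have hδpi : δ < Real.pi := (him z hz).trans_lt (hpi z hz)
  have hq0 : 0 < q := div_pos (Real.sin_pos_of_pos_of_lt_pi hδ hδpi) hδ
  have hq1 : q < 1 := (div_lt_one hδ).2 (Real.sin_lt hδ)
  have hiter : ∀ n : ℕ, ∀ z ∈ bddOrbits R, ∀ w ∈ bddOrbits R,
      Complex.normSq (z - w) * ((Complex.exp^[n] z).im * (Complex.exp^[n] w).im) ≤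
        q ^ n * (Complex.normSq (Complex.exp^[n] z - Complex.exp^[n] w) * (z.im * w.im)) := by
    intro n
    induction n with
    | zero => intro z _ w _; simp
    | succ n ih =>
      intro z hz w hw
      have hFz := exp_mem_bddOrbits hz
      have hFw := exp_mem_bddOrbits hw
      have h1 := Complex.normSq_mul_im_exp_le hδ (him z hz) (him w hw) (hpi z hz) (hpi w hw)
      have h2 := ih _ hFz _ hFw
      simp only [Function.iterate_succ_apply]
      have pz := hδ.trans_le (him z hz)
      have pw := hδ.trans_le (him w hw)
      have pFz := hδ.trans_le (him _ hFz)
      have pFw := hδ.trans_le (him _ hFw)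
      have pnz := hδ.trans_le (him _ (iterate_mem_bddOrbits hFz n))
      have pnw := hδ.trans_le (him _ (iterate_mem_bddOrbits hFw n))
      set I := (Complex.exp^[n] (Complex.exp z)).im * (Complex.exp^[n] (Complex.exp w)).im
      have hI : 0 < I := mul_pos pnz pnw
      set J := (Complex.exp z).im * (Complex.exp w).im
      have hJ : 0 < J := mul_pos pFz pFw
      refine le_of_mul_le_mul_right ?_ hJ
      calc Complex.normSq (z - w) * I * J = Complex.normSq (z - w) * J * I := by ring
        _ ≤ q * (Complex.normSq (Complex.exp z - Complex.exp w) * (z.im * w.im)) * I := by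
          gcongr
        _ = q * (z.im * w.im) * (Complex.normSq (Complex.exp z - Complex.exp w) * I) := by ring
        _ ≤ q * (z.im * w.im) * _ := mul_le_mul_of_nonneg_left h2 (by positivity)
        _ = _ := by ring
  have hbound : ∀ n : ℕ, Complex.normSq (z - w) * δ ^ 2 ≤ q ^ n * (K * (z.im * w.im)) := by
    intro n
    have hnz := iterate_mem_bddOrbits hz n
    have hnw := iterate_mem_bddOrbits hw n
    have pz := hδ.trans_le (him z hz)
    have pw := hδ.trans_le (him w hw)
    calc Complex.normSq (z - w) * δ ^ 2
        ≤ Complex.normSq (z - w) * ((Complex.exp^[n] z).im * (Complex.exp^[n] w).im) := by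
          rw [sq]
          exact mul_le_mul_of_nonneg_left
            (mul_le_mul (him _ hnz) (him _ hnw) hδ.le (hδ.le.trans (him _ hnz)))
            (Complex.normSq_nonneg _)
      _ ≤ _ := hiter n z hz w hw
      _ ≤ _ := by
        gcongr
        exact hK _ hnz _ hnw
  have hlim : Tendsto (fun n : ℕ => q ^ n * (K * (z.im * w.im))) atTop (𝓝 0) := by
    simpa using (tendsto_pow_atTop_nhds_zero_of_lt_one hq0.le hq1).mul_const (K * (z.im * w.im))
  have hle : Complex.normSq (z - w) * δ ^ 2 ≤ 0 := ge_of_tendsto' hlim hbound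
  have h0 : Complex.normSq (z - w) = 0 :=
    le_antisymm (nonpos_of_mul_nonpos_left hle (by positivity)) (Complex.normSq_nonneg _)
  exact sub_eq_zero.1 (Complex.normSq_eq_zero.1 h0)

/-! ### Countable decomposition and the dimension -/

theorem content_iterate_re_ge_eq_zero {s R : ℝ} (hs : 0 ≤ s)
    (hR : ∀ x, R ≤ x → hausdorffContent ℂ s (slab x (x + 1)) = 0) (n : ℕ) :
    hausdorffContent ℂ s {z ∈ devaneyContinuum | R ≤ (Complex.exp^[n] z).re} = 0 := by
  induction n with
  | zero =>
    refine measure_mono_null (t := ⋃ m : ℕ, slab (R + m) (R + m + 1)) ?_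
      (measure_iUnion_null fun m => hR _ (by simp))
    rintro z ⟨hz, hzR⟩
    have hzR : R ≤ z.re := hzR
    refine mem_iUnion.2 ⟨⌊z.re - R⌋₊, hz, ?_, ?_⟩
    · linarith [Nat.floor_le (sub_nonneg.2 hzR)]
    · linarith [Nat.lt_floor_add_one (z.re - R)]
  | succ n ih =>
    -- The expansion constant depends on a lower bound for `Re z`, so null content is pulled back
    -- through `exp` one slab at a time.
    refine measure_mono_null (t := ⋃ m : ℤ,
      {z ∈ slab m (m + 1) | R ≤ (Complex.exp^[n + 1] z).re}) ?_ (measure_iUnion_null fun m => ?_)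
    · rintro z ⟨hz, hzR⟩
      exact mem_iUnion.2 ⟨⌊z.re⌋, ⟨hz, Int.floor_le _, (Int.lt_floor_add_one _).le⟩, hzR⟩
    · refine le_antisymm ((hausdorffContent_le_image hs (κ := 2 * Real.exp (-(m : ℝ)))
        (by positivity) (f := Complex.exp)
        (B := {z ∈ devaneyContinuum | R ≤ (Complex.exp^[n] z).re})
        (fun z hz w hw => Complex.dist_le_mul_dist_exp hz.1.2.1 hw.1.2.1
          (im_mem hz.1.1) (im_mem hw.1.1)) (fun z hz => ⟨exp_mem hz.1.1, ?_⟩)).trans ?_) bot_le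
      · simpa only [Function.iterate_succ_apply] using hz.2
      · rw [ih, mul_zero]

theorem dimH_le_of_one_lt {s : ℝ≥0} (hs1 : 1 < s) (hs2 : s ≤ 2) : dimH devaneyContinuum ≤ s := by
  obtain ⟨R, hR⟩ := exists_content_slab_eq_zero (s := s) (by exact_mod_cast hs1)
    (by exact_mod_cast hs2)
  have hsub : devaneyContinuum ⊆ bddOrbits R ∪
      ⋃ n : ℕ, {z ∈ devaneyContinuum | R ≤ (Complex.exp^[n] z).re} := by
    intro z hz
    by_cases h : ∀ n, (Complex.exp^[n] z).re < R
    · exact Or.inl ⟨hz, h⟩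
    · push Not at h
      obtain ⟨n, hn⟩ := h
      exact Or.inr (mem_iUnion.2 ⟨n, hz, hn⟩)
  refine (dimH_mono hsub).trans ?_
  rw [dimH_union, dimH_iUnion, dimH_subsingleton (subsingleton_bddOrbits R)]
  exact max_le bot_le (iSup_le fun n => dimH_le_of_content_eq_zero (zero_lt_one.trans hs1)
    (content_iterate_re_ge_eq_zero s.2 hR n))

theorem one_le_dimH : 1 ≤ dimH devaneyContinuum := by
  rw [← Real.dimH_univ, ← Complex.isometry_ofReal.dimH_image univ]
  refine dimH_mono ?_
  rintro _ ⟨x, -, rfl⟩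
  exact ofReal_mem x

end devaneyContinuum

theorem theorem7p4 : dimH devaneyContinuum = 1 := by
  refine le_antisymm (le_of_forall_gt_imp_ge_of_dense fun c hc => ?_) devaneyContinuum.one_le_dimH
  obtain ⟨s, hs1, hsc⟩ := ENNReal.lt_iff_exists_nnreal_btwn.1 (lt_min hc ENNReal.one_lt_two)
  have hs2 : (s : ℝ≥0∞) ≤ 2 := hsc.le.trans (min_le_right _ _)
  exact (devaneyContinuum.dimH_le_of_one_lt (by exact_mod_cast hs1) (by exact_mod_cast hs2)).trans
    (hsc.le.trans (min_le_left _ _))
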